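/- Let $\Bbbk$ be a field of characteristic $0$ containing all roots of unity, $G$ a finite abelian group, $\widehat G=\mathrm{Hom}(G,\Bbbk^{\times})$, and let $\mathcal D$ be a datum consisting of $a,b\in G$ and $\chi\in\widehat G$ such that $n:=|\chi(a)|>1$, $\chi(a)=\chi(b)$ and $ab\neq 1$, where $|\chi(a)|$ denotes the order of $\chi(a)$ in $\Bbbk^{\times}$. Put $q=\chi(a^{-1})$. Let $H=H(\mathcal D)$ be the $\Bbbk$-algebra generated by $G$, $x$ and $y$ subject to the relations of $G$ and $$x^n=0=y^n,\qquad gx=\chi(g)\,xg,\qquad gy=\chi(g)^{-1}\,yg\quad(g\in G),\qquad xy-q\,yx=ab-1,$$ and let $Y$ be the subalgebra of $H$ generated by $G$ and $y$. For $\lambda\in\widehat G$ let $\Bbbk_\lambda$ be the one-dimensional $Y$-module $\Bbbk$ on which each $g\in G$ acts as the scalar $\lambda(g)$ and $y$ acts as $0$, and let $Z(\lambda)=H\otimes_Y\Bbbk_\lambda$. Then for every $\lambda\in\widehat G$ the sum $R(\lambda)$ of all proper $H$-submodules of $Z(\lambda)$ is the unique maximal submodule of $Z(\lambda)$; that is,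 $L(\lambda):=Z(\lambda)/R(\lambda)$ is the unique simple quotient of $Z(\lambda)$. The modules $L(\lambda)$, $\lambda\in\widehat G$, form a complete irredundant set of representatives of the isomorphism classes of simple (left) $H$-modules: every $L(\lambda)$ is simple, every simple $H$-module is isomorphic to $L(\lambda)$ for some $\lambda\in\widehat G$, and $L(\lambda)\cong L(\mu)$ implies $\lambda=\mu$. -/

import Mathlib

open scoped TensorProduct

universe u v w

noncomputable section

namespace QuantumPlane

/-- A datum `(G, a, b, χ, 1, 0)`: elements `a, b` of an abelian group `G` and a character
`χ : G → kˣ` with `|χ(a)| > 1` (finite order), `χ(a) = χ(b)` and `ab ≠ 1`. -/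
structure Datum (k : Type u) (G : Type v) [Field k] [CommGroup G] where
  a : G
  b : G
  χ : G →* kˣ
  one_lt_order : 1 < orderOf (χ a)
  χ_eq : χ a = χ b
  ab_ne_one : a * b ≠ 1

/-- The generators of `H(D)`: the elements of `G`, and `x`, `y`. -/
inductive Gen (G : Type v) : Type v
  | grp (g : G) : Gen G
  | x : Gen G
  | y : Gen G

variable {k : Type u} {G : Type v} [Field k] [CommGroup G]

namespace Datum

variable (D : Datum k G)

/-- `n = |χ(a)|`. -/
def n : ℕ := orderOf (D.χ D.a)

/-- `q = χ(a⁻¹)`. -/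
def q : k := (D.χ D.a⁻¹ : kˣ)

/-- The defining relations of `H(D)`, in the free algebra on the generators. -/
inductive Rel : FreeAlgebra k (Gen G) → FreeAlgebra k (Gen G) → Prop
  | grp_one : Rel (FreeAlgebra.ι k (Gen.grp 1)) 1
  | grp_mul (g h : G) :
      Rel (FreeAlgebra.ι k (Gen.grp (g * h)))
        (FreeAlgebra.ι k (Gen.grp g) * FreeAlgebra.ι k (Gen.grp h))
  | x_pow : Rel (FreeAlgebra.ι k Gen.x ^ D.n) 0
  | y_pow : Rel (FreeAlgebra.ι k Gen.y ^ D.n) 0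
  | grp_x (g : G) :
      Rel (FreeAlgebra.ι k (Gen.grp g) * FreeAlgebra.ι k Gen.x)
        ((D.χ g : k) • (FreeAlgebra.ι k Gen.x * FreeAlgebra.ι k (Gen.grp g)))
  | grp_y (g : G) :
      Rel (FreeAlgebra.ι k (Gen.grp g) * FreeAlgebra.ι k Gen.y)
        ((((D.χ g)⁻¹ : kˣ) : k) • (FreeAlgebra.ι k Gen.y * FreeAlgebra.ι k (Gen.grp g)))
  | x_y :
      Rel (FreeAlgebra.ι k Gen.x * FreeAlgebra.ι k Gen.y
          - D.q • (FreeAlgebra.ι k Gen.y * FreeAlgebra.ι k Gen.x))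
        (FreeAlgebra.ι k (Gen.grp (D.a * D.b)) - 1)

/-- The `k`-algebra `H = H(D)`, given by generators and relations. -/
def H : Type (max u v) := RingQuot D.Rel

instance : Ring D.H := inferInstanceAs (Ring (RingQuot D.Rel))

instance : Algebra k D.H := inferInstanceAs (Algebra k (RingQuot D.Rel))

/-- The image in `H(D)` of a generator. -/
def gen (s : Gen G) : D.H := RingQuot.mkAlgHom k D.Rel (FreeAlgebra.ι k s)

/-- The subalgebra `Y = ⟨G, y⟩` of `H(D)`. -/
def Y : Subalgebra k D.H :=
  Algebra.adjoin k (Set.range (fun g : G => D.gen (Gen.grp g)) ∪ {D.gen Gen.y})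

theorem grp_mem_Y (g : G) : D.gen (Gen.grp g) ∈ D.Y :=
  Algebra.subset_adjoin (Or.inl ⟨g, rfl⟩)

theorem y_mem_Y : D.gen Gen.y ∈ D.Y := Algebra.subset_adjoin (Or.inr rfl)

/-! Existence of the character of `Y` with `g ↦ λ(g)` and `y ↦ 0`: it is read off from an
`n`-dimensional representation of `H(D)` on which `Y` preserves a line. -/

section Existence

variable (l : G →* kˣ)

/-- The scalar by which `y` maps the `s`-th basis vector to the previous one. -/
def coef (s : ℕ) : k :=
  -(D.q⁻¹ ^ s * (∑ i ∈ Finset.range s, D.q ^ i) *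
    (D.q * D.q⁻¹ ^ s * (l (D.a * D.b) : k) - 1))

theorem q_ne_zero : D.q ≠ 0 := Units.ne_zero _

theorem q_eq : D.q = ((D.χ D.a : kˣ) : k)⁻¹ := by simp [q]

theorem sum_q : ∑ i ∈ Finset.range D.n, D.q ^ i = 0 := by
  have h : IsPrimitiveRoot ((D.χ D.a : kˣ) : k) D.n :=
    (IsPrimitiveRoot.orderOf (D.χ D.a)).map_of_injective (f := Units.coeHom k) Units.val_injective
  rw [q_eq]
  exact h.inv.geom_sum_eq_zero D.one_lt_order

theorem coef_zero : D.coef l 0 = 0 := by simp [coef]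

theorem coef_n : D.coef l D.n = 0 := by simp [coef, sum_q]

theorem coef_succ (s : ℕ) :
    D.coef l s - D.q * D.coef l (s + 1) =
      (l (D.a * D.b) : k) * (D.χ (D.a * D.b) : k) ^ s - 1 := by
  have h0 := D.q_ne_zero
  have h1 : ((D.χ (D.a * D.b) : kˣ) : k) = D.q⁻¹ * D.q⁻¹ := by
    rw [map_mul, ← D.χ_eq, q_eq]; simp
  have h2 : D.q * ∑ i ∈ Finset.range s, D.q ^ i =
      ∑ i ∈ Finset.range s, D.q ^ i + D.q ^ s - 1 := by
    have := Finset.sum_range_succ (fun i => D.q ^ i) s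
    have h3 := Finset.sum_range_succ' (fun i => D.q ^ i) s
    rw [this, pow_zero] at h3
    rw [Finset.mul_sum, h3]
    simp [pow_succ']
  rw [h1, coef, coef, Finset.sum_range_succ]
  generalize (∑ i ∈ Finset.range s, D.q ^ i) = S at *
  have h4 : D.q⁻¹ ^ s * D.q ^ s = 1 := by rw [← mul_pow, inv_mul_cancel₀ h0, one_pow]
  have h5 : D.q⁻¹ * D.q = 1 := inv_mul_cancel₀ h0
  rw [mul_pow, pow_succ]
  generalize D.q⁻¹ ^ s = t at *
  generalize D.q ^ s = p at *
  generalize D.q⁻¹ = r at *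
  generalize ((l (D.a * D.b) : kˣ) : k) = L at *
  linear_combination (-(L * t * t)) * h2 - h4 +
    (t * (S + p) * (t * L * (r * D.q + 1) - 1)) * h5

/-- The value of `f` at `i`, extended by zero. -/
def ext0 {n : ℕ} (f : Fin n → k) (i : ℕ) : k := if h : i < n then f ⟨i, h⟩ else 0

theorem ext0_mk {n : ℕ} (F : ℕ → k) (i : ℕ) :
    ext0 (fun j : Fin n => F j) i = if i < n then F i else 0 := by
  unfold ext0; split_ifs <;> rfl

theorem ext0_add {n : ℕ} (f g : Fin n → k) (i : ℕ) : ext0 (f + g) i = ext0 f i + ext0 g i := by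
  unfold ext0; split_ifs <;> simp

theorem ext0_smul {n : ℕ} (c : k) (f : Fin n → k) (i : ℕ) : ext0 (c • f) i = c * ext0 f i := by
  unfold ext0; split_ifs <;> simp

theorem ext0_coe {n : ℕ} (f : Fin n → k) (i : Fin n) : ext0 f i = f i := by simp [ext0]

/-- The action of `x`. -/
def opX : Module.End k (Fin D.n → k) where
  toFun f := fun i => if (i : ℕ) = 0 then 0 else ext0 f (i - 1)
  map_add' f g := by funext i; simp only [Pi.add_apply, ext0_add]; split_ifs <;> simp
  map_smul' c f := by
    funext i; simp only [Pi.smul_apply, ext0_smul, RingHom.id_apply, smul_eq_mul]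
    split_ifs <;> simp

/-- The action of `y`. -/
def opY : Module.End k (Fin D.n → k) where
  toFun f := fun i => D.coef l (i + 1) * ext0 f (i + 1)
  map_add' f g := by funext i; simp only [Pi.add_apply, ext0_add]; ring
  map_smul' c f := by
    funext i; simp only [Pi.smul_apply, ext0_smul, RingHom.id_apply, smul_eq_mul]; ring

/-- The action of a group element. -/
def opG (g : G) : Module.End k (Fin D.n → k) where
  toFun f := fun i => (l g : k) * (D.χ g : k) ^ (i : ℕ) * f i
  map_add' f g := by funext i; simp only [Pi.add_apply]; ring
  map_smul' c f := by
    funext i; simp only [Pi.smul_apply, RingHom.id_apply, smul_eq_mul]; ring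

theorem ext0_opX (f : Fin D.n → k) (i : ℕ) (hi : i < D.n) :
    ext0 (D.opX f) i = if i = 0 then 0 else ext0 f (i - 1) := by simp [ext0, opX, hi]

theorem ext0_opY (f : Fin D.n → k) (i : ℕ) (hi : i < D.n) :
    ext0 (D.opY l f) i = D.coef l (i + 1) * ext0 f (i + 1) := by simp [ext0, opY, hi]

theorem ext0_opG (g : G) (f : Fin D.n → k) (i : ℕ) :
    ext0 (D.opG l g f) i = (l g : k) * (D.χ g : k) ^ i * ext0 f i := by
  by_cases hi : i < D.n <;> simp [ext0, opG, hi]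

theorem ext0_of_le {n : ℕ} (f : Fin n → k) (i : ℕ) (hi : n ≤ i) : ext0 f i = 0 := by
  simp [ext0, hi]

theorem opX_pow (m i : ℕ) (hi : i < m) (f : Fin D.n → k) : ext0 ((D.opX ^ m) f) i = 0 := by
  by_cases hn : i < D.n
  swap
  · exact ext0_of_le _ _ (not_lt.mp hn)
  induction m generalizing i with
  | zero => omega
  | succ m ih =>
    rw [pow_succ', Module.End.mul_apply, ext0_opX _ _ _ hn]
    split_ifs with h
    · rfl
    · exact ih _ (by omega) (by omega)

theorem opY_pow (m i : ℕ) (hi : D.n ≤ i + m) (f : Fin D.n → k) :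
    ext0 ((D.opY l ^ m) f) i = 0 := by
  induction m generalizing i with
  | zero => exact ext0_of_le _ _ hi
  | succ m ih =>
    by_cases hn : i < D.n
    · rw [pow_succ', Module.End.mul_apply, ext0_opY _ _ _ _ hn, ih _ (by omega), mul_zero]
    · exact ext0_of_le _ _ (not_lt.mp hn)

theorem end_ext {n : ℕ} {A B : Module.End k (Fin n → k)}
    (h : ∀ f (i : ℕ), i < n → ext0 (A f) i = ext0 (B f) i) : A = B := by
  refine LinearMap.ext fun f => funext fun i => ?_
  rw [← ext0_coe (A f), ← ext0_coe (B f)]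
  exact h f i i.2

theorem ext0_zero {n : ℕ} (i : ℕ) : ext0 (0 : Fin n → k) i = 0 := by simp [ext0]

/-- The representation on generators. -/
def opGen : Gen G → Module.End k (Fin D.n → k)
  | Gen.grp g => D.opG l g
  | Gen.x => D.opX
  | Gen.y => D.opY l

theorem opGen_rel {s t : FreeAlgebra k (Gen G)} (h : D.Rel s t) :
    FreeAlgebra.lift k (D.opGen l) s = FreeAlgebra.lift k (D.opGen l) t := by
  cases h with
  | grp_one =>
    simp only [FreeAlgebra.lift_ι_apply, map_one, opGen]
    refine end_ext fun f i _ => ?_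
    simp [ext0_opG]
  | grp_mul g h =>
    simp only [FreeAlgebra.lift_ι_apply, map_mul, opGen]
    refine end_ext fun f i _ => ?_
    simp only [ext0_opG, Module.End.mul_apply, map_mul, Units.val_mul, mul_pow]
    ring
  | x_pow =>
    simp only [FreeAlgebra.lift_ι_apply, map_pow, map_zero, opGen]
    refine end_ext fun f i hi => ?_
    rw [D.opX_pow _ _ hi, LinearMap.zero_apply, ext0_zero]
  | y_pow =>
    simp only [FreeAlgebra.lift_ι_apply, map_pow, map_zero, opGen]
    refine end_ext fun f i hi => ?_
    rw [D.opY_pow l _ _ (by omega), LinearMap.zero_apply, ext0_zero]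
  | grp_x g =>
    simp only [FreeAlgebra.lift_ι_apply, map_mul, map_smul, opGen]
    refine end_ext fun f i hi => ?_
    simp only [Module.End.mul_apply, LinearMap.smul_apply, ext0_smul, ext0_opG, ext0_opX _ _ _ hi]
    rcases i with _ | i
    · simp
    · simp only [Nat.add_eq_zero_iff, one_ne_zero, and_false, if_false, Nat.add_sub_cancel]
      ring
  | grp_y g =>
    simp only [FreeAlgebra.lift_ι_apply, map_mul, map_smul, opGen]
    refine end_ext fun f i hi => ?_
    simp only [Module.End.mul_apply, LinearMap.smul_apply, ext0_smul, ext0_opG,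
      ext0_opY _ _ _ _ hi]
    have : (((D.χ g)⁻¹ : kˣ) : k) * (D.χ g : k) = 1 := by simp
    linear_combination (-(l g : k) * (D.χ g : k) ^ i * D.coef l (i + 1) * ext0 f (i + 1)) * this
  | x_y =>
    simp only [FreeAlgebra.lift_ι_apply, map_mul, map_smul, map_sub, map_one, opGen]
    refine end_ext fun f i hi => ?_
    have hs : ∀ u v : Fin D.n → k, ext0 (u - v) i = ext0 u i - ext0 v i := by
      intro u v; simp [ext0, hi]
    simp only [Module.End.mul_apply, LinearMap.smul_apply, LinearMap.sub_apply, hs, ext0_smul,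
      ext0_opG, ext0_opX _ _ _ hi, ext0_opY _ _ _ _ hi, Module.End.one_apply]
    have h1 : (if i = 0 then 0 else ext0 (D.opY l f) (i - 1)) = D.coef l i * ext0 f i := by
      rcases i with _ | i
      · simp [coef_zero]
      · rw [if_neg (by omega), Nat.add_sub_cancel, ext0_opY _ _ _ _ (by omega)]
    have h2 : D.coef l (i + 1) * ext0 (D.opX f) (i + 1) = D.coef l (i + 1) * ext0 f i := by
      by_cases hn : i + 1 < D.n
      · rw [ext0_opX _ _ _ hn, if_neg (by omega), Nat.add_sub_cancel]
      · have : i + 1 = D.n := by omega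
        rw [this, coef_n, zero_mul, zero_mul]
    rw [h1, h2]
    linear_combination ext0 f i * D.coef_succ l i

/-- An `n`-dimensional representation of `H(D)`. -/
def rep : D.H →ₐ[k] Module.End k (Fin D.n → k) :=
  RingQuot.liftAlgHom k ⟨FreeAlgebra.lift k (D.opGen l), fun _ _ h => D.opGen_rel l h⟩

theorem rep_gen (s : Gen G) : D.rep l (D.gen s) = D.opGen l s := by
  refine (RingQuot.liftAlgHom_mkAlgHom_apply k _ _ _).trans ?_
  simp

theorem n_pos : 0 < D.n := lt_trans one_pos D.one_lt_order

/-- The vector spanning the line preserved by `Y`. -/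
def v0 : Fin D.n → k := Pi.single ⟨0, D.n_pos⟩ 1

theorem rep_grp_v0 (g : G) : D.rep l (D.gen (Gen.grp g)) D.v0 = (l g : k) • D.v0 := by
  rw [rep_gen]
  funext i
  by_cases h : i = ⟨0, D.n_pos⟩
  · subst h; simp [opGen, opG, v0]
  · simp [opGen, opG, v0, h]

theorem rep_y_v0 : D.rep l (D.gen Gen.y) D.v0 = (0 : k) • D.v0 := by
  rw [rep_gen]
  funext i
  simp only [opGen, opY, v0, LinearMap.coe_mk, AddHom.coe_mk, zero_smul, Pi.zero_apply, ext0]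
  split_ifs with h
  · simp
  · simp

theorem rep_Y_v0 (u : D.H) (hu : u ∈ D.Y) : ∃ c : k, D.rep l u D.v0 = c • D.v0 := by
  induction hu using Algebra.adjoin_induction with
  | mem u hu =>
    rcases hu with ⟨g, rfl⟩ | rfl
    · exact ⟨_, D.rep_grp_v0 l g⟩
    · exact ⟨_, D.rep_y_v0 l⟩
  | algebraMap r => exact ⟨r, by simp⟩
  | add u v _ _ hu hv =>
    obtain ⟨c, hc⟩ := hu
    obtain ⟨d, hd⟩ := hv
    exact ⟨c + d, by rw [map_add, LinearMap.add_apply, hc, hd, add_smul]⟩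
  | mul u v _ _ hu hv =>
    obtain ⟨c, hc⟩ := hu
    obtain ⟨d, hd⟩ := hv
    exact ⟨d * c, by rw [map_mul, Module.End.mul_apply, hd, map_smul, hc, smul_smul]⟩

theorem smul_v0_apply (c : k) : (c • D.v0) ⟨0, D.n_pos⟩ = c := by simp [v0]

/-- For each `λ ∈ Ĝ` there is exactly one character of `Y` with `g ↦ λ(g)`, `y ↦ 0`. -/
theorem existsUnique_weightChar :
    ∃! φ : D.Y →ₐ[k] k, (∀ g : G, φ ⟨D.gen (Gen.grp g), D.grp_mem_Y g⟩ = l g) ∧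
      φ ⟨D.gen Gen.y, D.y_mem_Y⟩ = 0 := by
  have key : ∀ u : D.Y, D.rep l u D.v0 = (D.rep l u D.v0 ⟨0, D.n_pos⟩) • D.v0 := by
    intro u
    obtain ⟨c, hc⟩ := D.rep_Y_v0 l u u.2
    rw [hc, smul_v0_apply]
  refine ⟨AlgHom.ofLinearMap
    { toFun := fun u : D.Y => D.rep l u D.v0 ⟨0, D.n_pos⟩
      map_add' := fun u v => by simp
      map_smul' := fun c u => by simp } ?_ ?_, ⟨fun g => ?_, ?_⟩, ?_⟩
  · simp [v0]
  · intro u v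
    simp only [LinearMap.coe_mk, AddHom.coe_mk, MulMemClass.coe_mul, map_mul,
      Module.End.mul_apply]
    conv_lhs => rw [key v, map_smul, key u, smul_smul, smul_v0_apply, mul_comm]
  · simp only [AlgHom.ofLinearMap_apply, LinearMap.coe_mk, AddHom.coe_mk, rep_grp_v0,
      smul_v0_apply]
  · simp only [AlgHom.ofLinearMap_apply, LinearMap.coe_mk, AddHom.coe_mk, rep_y_v0,
      smul_v0_apply]
  · rintro ψ ⟨hg, hy⟩
    have hψ : ∀ (u : D.H) (hu : u ∈ D.Y), D.rep l u D.v0 = ψ ⟨u, hu⟩ • D.v0 := by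
      intro u hu
      induction hu using Algebra.adjoin_induction with
      | mem u hu =>
        rcases hu with ⟨g, rfl⟩ | rfl
        · exact (D.rep_grp_v0 l g).trans (congrArg (· • D.v0) (hg g).symm)
        · exact (D.rep_y_v0 l).trans (congrArg (· • D.v0) hy.symm)
      | algebraMap r =>
        have h : ψ (algebraMap k D.Y r) = r := ψ.commutes r
        refine Eq.trans ?_ (congrArg (· • D.v0) h.symm)
        simp
      | add u v hu' hv' hu hv =>
        have h := map_add ψ ⟨u, hu'⟩ ⟨v, hv'⟩
        refine Eq.trans ?_ (congrArg (· • D.v0) h.symm)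
        rw [map_add, LinearMap.add_apply, hu, hv, ← add_smul]
      | mul u v hu' hv' hu hv =>
        have h := map_mul ψ ⟨u, hu'⟩ ⟨v, hv'⟩
        refine Eq.trans ?_ (congrArg (· • D.v0) h.symm)
        rw [map_mul, Module.End.mul_apply, hv, map_smul, hu, smul_smul, mul_comm]
    refine AlgHom.ext fun u => ?_
    simp only [AlgHom.ofLinearMap_apply, LinearMap.coe_mk, AddHom.coe_mk]
    rw [hψ u u.2, smul_v0_apply]

end Existence

/-- The character of `Y` extending `λ ∈ Ĝ` by `y ↦ 0`. -/
def weightChar (l : G →* kˣ) : D.Y →ₐ[k] k := (D.existsUnique_weightChar l).choose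

theorem weightChar_grp (l : G →* kˣ) (g : G) :
    D.weightChar l ⟨D.gen (Gen.grp g), D.grp_mem_Y g⟩ = l g :=
  (D.existsUnique_weightChar l).choose_spec.1.1 g

theorem weightChar_y (l : G →* kˣ) : D.weightChar l ⟨D.gen Gen.y, D.y_mem_Y⟩ = 0 :=
  (D.existsUnique_weightChar l).choose_spec.1.2

/-- The one-dimensional `Y`-module `k_λ`: the space `k`, on which `g ∈ G` acts as `λ(g)` and
`y` acts as `0`. -/
def OneDim (_D : Datum k G) (_l : G →* kˣ) : Type u := k

instance (l : G →* kˣ) : AddCommGroup (D.OneDim l) := inferInstanceAs (AddCommGroup k)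

instance (l : G →* kˣ) : Module k (D.OneDim l) := inferInstanceAs (Module k k)

instance (l : G →* kˣ) : Module D.Y (D.OneDim l) :=
  Module.compHom k (D.weightChar l).toRingHom

end Datum

/-- The `A`-module `A ⊗_B V` induced from a module `V` over a subalgebra `B` of a `k`-algebra `A`
(noncommutative rings): the quotient of `A ⊗_k V` by the elements `ab ⊗ v - a ⊗ bv`. -/
def Induced {k : Type u} {A : Type v} [Field k] [Ring A] [Algebra k A] (B : Subalgebra k A)
    (V : Type w) [AddCommGroup V] [Module k V] [Module B V] : Type (max v w) :=
  (A ⊗[k] V) ⧸ Submodule.span A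
    {t : A ⊗[k] V | ∃ (a : A) (b : B) (v : V), t = (a * (b : A)) ⊗ₜ[k] v - a ⊗ₜ[k] (b • v)}

section Induced

variable {A : Type v} [Ring A] [Algebra k A] (B : Subalgebra k A)
  (V : Type w) [AddCommGroup V] [Module k V] [Module B V]

instance : AddCommGroup (Induced B V) := inferInstanceAs (AddCommGroup ((A ⊗[k] V) ⧸ _))

instance : Module A (Induced B V) :=
  inferInstanceAs (Module A ((A ⊗[k] V) ⧸ Submodule.span A
    {t : A ⊗[k] V | ∃ (a : A) (b : B) (v : V), t = (a * (b : A)) ⊗ₜ[k] v - a ⊗ₜ[k] (b • v)}))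

end Induced

namespace Datum

variable (D : Datum k G)

/-- The Verma-type module `Z(λ) = H ⊗_Y k_λ`. -/
abbrev Z (l : G →* kˣ) : Type (max u v) := Induced D.Y (D.OneDim l)

/-- `R(λ)`: the sum of all proper submodules of `Z(λ)`. -/
def R (l : G →* kˣ) : Submodule D.H (D.Z l) := sSup {N | N ≠ ⊤}

/-- `L(λ) = Z(λ) / R(λ)`. -/
abbrev L (l : G →* kˣ) : Type (max u v) := D.Z l ⧸ D.R l

end Datum

end QuantumPlane

end

/-!
The modules `Z(λ)` are highest weight modules for the "triangular" algebra `H(D)`. Call a vector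
`v` of an `H(D)`-module *primitive* of weight `λ` if `g v = λ(g) v` for all `g ∈ G` and `y v = 0`.
The commutation relations show that the vectors `x ^ i v` with `i < n` span the submodule generated
by `v` (`IsPrimitive.mem_span_x_pow`), and `x ^ i v` has weight `λ χ ^ i`. As `χ(a)` has order `n`,
the weight `λ` occurs among these only for `i = 0`, so the (unnormalised) projection
`weightSum λ = ∑ λ(g)⁻¹ g` onto the weight space of `λ` maps the module generated by `v` into
`k v`, and annihilates `x • z` for each `z` in it.

*Unique maximal submodule.* If some element of a submodule `N` of `Z(λ)` has a nonzero projection,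
then `N` contains the generator, so `N = ⊤`. Hence the proper submodules are those killed by
`weightSum λ`, and so their sum is again proper. The generator itself is nonzero because `Z(λ)`
maps onto a submodule of the explicit representation `rep λ`, and there `v0 ≠ 0`.

*Exhaustion.* In a nonzero module, `y ^ n = 0` yields a nonzero vector `m` with `y m = 0`. Since
characters separate the points of `G` (enough roots of unity), `∑_λ weightSum λ` is a nonzero
scalar, so `weightSum λ • m ≠ 0` for some `λ`; this is a primitive vector, and a simple module
containing it is a quotient of `Z(λ)`, hence is `L(λ)`.

*Irredundancy.* On `L(λ)` the operator `weightSum λ` is nonzero but kills all multiples of `x`.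
On `L(μ)` with `μ ≠ λ` an operator `weightSum λ` killing all multiples of `x` is zero, because it
kills the generator, which has weight `μ`.
-/

open scoped TensorProduct

noncomputable section

namespace QuantumPlane

namespace Datum

variable {k : Type u} {G : Type v} [Field k] [CommGroup G] (D : Datum k G)

/-! ### Relations and induction in `H(D)` -/

theorem gen_grp_one : D.gen (Gen.grp 1) = 1 := by
  simpa [gen] using! RingQuot.mkAlgHom_rel k (Rel.grp_one (D := D))

theorem gen_grp_mul (g h : G) :
    D.gen (Gen.grp (g * h)) = D.gen (Gen.grp g) * D.gen (Gen.grp h) := by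
  have := RingQuot.mkAlgHom_rel k (Rel.grp_mul (D := D) g h)
  rw [map_mul] at this
  exact this

theorem gen_x_pow : D.gen Gen.x ^ D.n = 0 := by
  have := RingQuot.mkAlgHom_rel k (Rel.x_pow (D := D))
  rw [map_pow, map_zero] at this
  exact this

theorem gen_y_pow : D.gen Gen.y ^ D.n = 0 := by
  have := RingQuot.mkAlgHom_rel k (Rel.y_pow (D := D))
  rw [map_pow, map_zero] at this
  exact this

theorem gen_grp_x (g : G) : D.gen (Gen.grp g) * D.gen Gen.x =
    (D.χ g : k) • (D.gen Gen.x * D.gen (Gen.grp g)) := by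
  have := RingQuot.mkAlgHom_rel k (Rel.grp_x (D := D) g)
  rw [map_smul, map_mul, map_mul] at this
  exact this

theorem gen_y_grp (g : G) : D.gen Gen.y * D.gen (Gen.grp g) =
    (D.χ g : k) • (D.gen (Gen.grp g) * D.gen Gen.y) := by
  have := RingQuot.mkAlgHom_rel k (Rel.grp_y (D := D) g)
  rw [map_smul, map_mul, map_mul] at this
  change D.gen (Gen.grp g) * D.gen Gen.y =
    (((D.χ g)⁻¹ : kˣ) : k) • (D.gen Gen.y * D.gen (Gen.grp g)) at this
  rw [this, smul_smul, Units.mul_inv, one_smul]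

theorem gen_y_x : D.gen Gen.y * D.gen Gen.x =
    D.q⁻¹ • (D.gen Gen.x * D.gen Gen.y - D.gen (Gen.grp (D.a * D.b)) + 1) := by
  have := RingQuot.mkAlgHom_rel k (Rel.x_y (D := D))
  rw [map_sub, map_sub, map_smul, map_mul, map_mul, map_one] at this
  change D.gen Gen.x * D.gen Gen.y - D.q • (D.gen Gen.y * D.gen Gen.x) =
    D.gen (Gen.grp (D.a * D.b)) - 1 at this
  have h : D.gen Gen.x * D.gen Gen.y - D.gen (Gen.grp (D.a * D.b)) + 1 =
      D.q • (D.gen Gen.y * D.gen Gen.x) := by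
    rw [sub_eq_iff_eq_add] at this
    rw [this]; abel
  rw [h, smul_smul, inv_mul_cancel₀ D.q_ne_zero, one_smul]

theorem H_induction {p : D.H → Prop} (algebraMap : ∀ c : k, p (algebraMap k D.H c))
    (gen : ∀ s, p (D.gen s)) (mul : ∀ u v, p u → p v → p (u * v))
    (add : ∀ u v, p u → p v → p (u + v)) (u : D.H) : p u := by
  obtain ⟨t, rfl⟩ := RingQuot.mkAlgHom_surjective k D.Rel u
  induction t using FreeAlgebra.induction with
  | grade0 c => rw [AlgHom.commutes]; exact algebraMap c
  | grade1 s => exact gen s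
  | mul s t hs ht => rw [map_mul]; exact mul _ _ hs ht
  | add s t hs ht => rw [map_add]; exact add _ _ hs ht

variable {M : Type*} [AddCommGroup M] [Module D.H M] [Module k M] [IsScalarTower k D.H M]

theorem smul_mem_of_gen_smul_mem (S : Submodule k M) (hS : ∀ s, ∀ z ∈ S, D.gen s • z ∈ S)
    (u : D.H) : ∀ z ∈ S, u • z ∈ S := by
  induction u using D.H_induction with
  | algebraMap c => intro z hz; rw [algebraMap_smul]; exact S.smul_mem _ hz
  | gen s => exact hS s
  | mul u v hu hv => intro z hz; rw [mul_smul]; exact hu _ (hv _ hz)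
  | add u v hu hv => intro z hz; rw [add_smul]; exact S.add_mem (hu _ hz) (hv _ hz)

/-! ### Weight vectors and projections onto weight spaces -/

/-- The vector `v` has weight `l`: each `g ∈ G` acts on it as the scalar `l g`. The zero vector has
every weight. -/
def IsWeightVector (l : G →* kˣ) (v : M) : Prop :=
  ∀ g, D.gen (Gen.grp g) • v = (l g : k) • v

/-- The vector `v` is primitive of weight `l`: it has weight `l` and is killed by `y`. -/
structure IsPrimitive (l : G →* kˣ) (v : M) : Prop where
  weight : D.IsWeightVector l v
  y_smul : D.gen Gen.y • v = 0

variable {D}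

theorem IsWeightVector.x_smul {l : G →* kˣ} {v : M} (h : D.IsWeightVector l v) :
    D.IsWeightVector (l * D.χ) (D.gen Gen.x • v) := by
  intro g
  rw [← mul_smul, gen_grp_x, smul_assoc, mul_smul, h g, smul_algebra_smul_comm, smul_smul,
    MonoidHom.mul_apply, Units.val_mul, mul_comm]

theorem IsWeightVector.x_pow_smul {l : G →* kˣ} {v : M} (h : D.IsWeightVector l v) (i : ℕ) :
    D.IsWeightVector (l * D.χ ^ i) (D.gen Gen.x ^ i • v) := by
  induction i with
  | zero =>
    have hl : l * D.χ ^ 0 = l := by ext g; simp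
    rwa [hl, pow_zero, one_smul]
  | succ i ih =>
    have hl : l * D.χ ^ (i + 1) = l * D.χ ^ i * D.χ := by ext g; simp [pow_succ, mul_assoc]
    rw [hl, pow_succ', mul_smul]
    exact ih.x_smul

theorem IsPrimitive.mem_span_x_pow {l : G →* kˣ} {v : M} (h : D.IsPrimitive l v) (u : D.H) :
    u • v ∈ Submodule.span k (Set.range fun i : ℕ => D.gen Gen.x ^ i • v) := by
  set S := Submodule.span k (Set.range fun i : ℕ => D.gen Gen.x ^ i • v)
  have hx : ∀ i : ℕ, D.gen Gen.x ^ i • v ∈ S := fun i => Submodule.subset_span ⟨i, rfl⟩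
  -- It is enough to check stability under the generators on the spanning vectors.
  have key : ∀ s : Gen G, (∀ i : ℕ, D.gen s • D.gen Gen.x ^ i • v ∈ S) →
      ∀ z ∈ S, D.gen s • z ∈ S := by
    intro s hs z hz
    induction hz using Submodule.span_induction with
    | mem z hz => obtain ⟨i, rfl⟩ := hz; exact hs i
    | zero => rw [smul_zero]; exact S.zero_mem
    | add z w _ _ hz hw => rw [smul_add]; exact S.add_mem hz hw
    | smul c z _ hz => rw [smul_algebra_smul_comm]; exact S.smul_mem _ hz
  have hX := key Gen.x fun i => by rw [← mul_smul, ← pow_succ']; exact hx (i + 1)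
  have hG : ∀ g (i : ℕ), D.gen (Gen.grp g) • D.gen Gen.x ^ i • v ∈ S := fun g i => by
    rw [h.weight.x_pow_smul i g]; exact S.smul_mem _ (hx i)
  refine D.smul_mem_of_gen_smul_mem S (fun s => ?_) u v (by simpa using hx 0)
  rcases s with g | _ | _
  · exact key _ (hG g)
  · exact hX
  · refine key _ fun i => ?_
    induction i with
    | zero => rw [pow_zero, one_smul, h.y_smul]; exact S.zero_mem
    | succ i ih =>
      rw [pow_succ', mul_smul, ← mul_smul, gen_y_x, smul_assoc, add_smul, sub_smul, one_smul,
        mul_smul]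
      exact S.smul_mem _ (S.add_mem (S.sub_mem (hX _ ih) (hG _ i)) (hx i))

section Fintype

variable [Fintype G]

variable (D) in
/-- The element `∑ l(g)⁻¹ g` of `H(D)`: it is `|G|` times the projection onto the vectors of
weight `l`. -/
def weightSum (l : G →* kˣ) : D.H := ∑ g : G, ((l g)⁻¹ : kˣ).val • D.gen (Gen.grp g)

theorem weightSum_smul (l : G →* kˣ) (v : M) :
    D.weightSum l • v = ∑ g : G, ((l g)⁻¹ : kˣ).val • D.gen (Gen.grp g) • v := by
  simp only [weightSum, Finset.sum_smul, smul_assoc]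

theorem IsWeightVector.weightSum_smul {l : G →* kˣ} {v : M} (h : D.IsWeightVector l v) :
    D.weightSum l • v = (Fintype.card G : k) • v := by
  rw [Datum.weightSum_smul]
  simp only [h _, smul_smul, Units.inv_mul, one_smul, Finset.sum_const, Finset.card_univ,
    Nat.cast_smul_eq_nsmul]

theorem IsWeightVector.weightSum_smul_of_ne {l m : G →* kˣ} {v : M} (h : D.IsWeightVector m v)
    (hlm : l ≠ m) : D.weightSum l • v = 0 := by
  have h0 := sum_hom_units_eq_zero ((Units.coeHom k).comp (l⁻¹ * m)) fun h1 => hlm <| by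
    ext g
    have h2 : ((l g)⁻¹ * m g : kˣ) = 1 := Units.ext (DFunLike.congr_fun h1 g)
    rw [inv_mul_eq_one.mp h2]
  rw [Datum.weightSum_smul]
  simp only [h _, smul_smul, ← Finset.sum_smul]
  rw [← zero_smul k v, ← h0]
  congr

theorem IsWeightVector.weightSum_x_pow_smul {l : G →* kˣ} {v : M} (h : D.IsWeightVector l v)
    {i : ℕ} (hi : i ≠ 0) : D.weightSum l • D.gen Gen.x ^ i • v = 0 := by
  by_cases hn : i < D.n
  · refine (h.x_pow_smul i).weightSum_smul_of_ne fun hl => ?_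
    have h1 : D.χ D.a ^ i = 1 := by
      simpa using DFunLike.congr_fun hl D.a
    exact hn.not_ge (Nat.le_of_dvd (Nat.pos_of_ne_zero hi) (orderOf_dvd_of_pow_eq_one h1))
  · rw [pow_eq_zero_of_le (not_lt.mp hn) D.gen_x_pow, zero_smul, smul_zero]

theorem IsPrimitive.weightSum_smul_mem {l : G →* kˣ} {v : M} (h : D.IsPrimitive l v) (u : D.H) :
    ∃ c : k, D.weightSum l • u • v = c • v := by
  have hz := h.mem_span_x_pow u
  generalize u • v = z at hz ⊢
  induction hz using Submodule.span_induction with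
  | mem z hz =>
    obtain ⟨i, rfl⟩ := hz
    by_cases hi : i = 0
    · exact ⟨_, by simpa [hi] using h.weight.weightSum_smul⟩
    · exact ⟨0, by simpa using h.weight.weightSum_x_pow_smul hi⟩
  | zero => exact ⟨0, by simp⟩
  | add z w _ _ hz hw =>
    obtain ⟨c, hc⟩ := hz
    obtain ⟨d, hd⟩ := hw
    exact ⟨c + d, by rw [smul_add, hc, hd, add_smul]⟩
  | smul c z _ hz =>
    obtain ⟨d, hd⟩ := hz
    exact ⟨c * d, by rw [smul_algebra_smul_comm, hd, mul_smul]⟩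

theorem IsPrimitive.weightSum_x_smul {l : G →* kˣ} {v : M} (h : D.IsPrimitive l v) (u : D.H) :
    D.weightSum l • D.gen Gen.x • u • v = 0 := by
  have hz := h.mem_span_x_pow u
  generalize u • v = z at hz ⊢
  induction hz using Submodule.span_induction with
  | mem z hz =>
    obtain ⟨i, rfl⟩ := hz
    rw [← mul_smul (D.gen Gen.x), ← pow_succ']
    exact h.weight.weightSum_x_pow_smul i.succ_ne_zero
  | zero => simp
  | add z w _ _ hz hw => rw [smul_add, smul_add, hz, hw, add_zero]
  | smul c z _ hz => rw [smul_algebra_smul_comm, smul_algebra_smul_comm, hz, smul_zero]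

/-- If the projection to the weight `l` kills all multiples of `x`, then it vanishes on a module
generated by a primitive vector of another weight. -/
theorem IsPrimitive.weightSum_smul_eq_zero {l m : G →* kˣ} {v : M} (h : D.IsPrimitive m v)
    (hlm : l ≠ m) (hx : ∀ z : M, D.weightSum l • D.gen Gen.x • z = 0) (u : D.H) :
    D.weightSum l • u • v = 0 := by
  have hz := h.mem_span_x_pow u
  generalize u • v = z at hz ⊢
  induction hz using Submodule.span_induction with
  | mem z hz =>
    obtain ⟨i, rfl⟩ := hz
    rcases i with _ | i
    · simpa using h.weight.weightSum_smul_of_ne hlm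
    · dsimp only
      rw [pow_succ', mul_smul]
      exact hx _
  | zero => simp
  | add z w _ _ hz hw => rw [smul_add, hz, hw, add_zero]
  | smul c z _ hz => rw [smul_algebra_smul_comm, hz, smul_zero]

theorem isPrimitive_weightSum_smul (l : G →* kˣ) {v : M} (hv : D.gen Gen.y • v = 0) :
    D.IsPrimitive l (D.weightSum l • v) where
  weight g := by
    rw [weightSum_smul, Finset.smul_sum, Finset.smul_sum]
    refine Fintype.sum_equiv (Equiv.mulLeft g) _ _ fun h => ?_
    rw [smul_algebra_smul_comm, ← mul_smul, ← gen_grp_mul, smul_smul, Equiv.coe_mulLeft, map_mul,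
      mul_inv, Units.val_mul, Units.mul_inv_cancel_left]
  y_smul := by
    rw [weightSum_smul, Finset.smul_sum]
    refine Finset.sum_eq_zero fun g _ => ?_
    rw [smul_algebra_smul_comm, ← mul_smul, gen_y_grp, smul_assoc, mul_smul, hv]
    simp

/-- The weight projections add up to the identity (up to a nonzero scalar) when the characters of
`G` separate its points. -/
theorem exists_weightSum_smul_ne_zero [CharZero k]
    (hroots : ∀ m : ℕ, 0 < m → ∃ ζ : k, IsPrimitiveRoot ζ m) {v : M} (hv : v ≠ 0) :
    ∃ l : G →* kˣ, D.weightSum l • v ≠ 0 := by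
  have : NeZero (Monoid.exponent G) := ⟨Monoid.exponent_ne_zero_of_finite⟩
  have : HasEnoughRootsOfUnity k (Monoid.exponent G) :=
    ⟨hroots _ (NeZero.pos _), inferInstance⟩
  have : Fintype (G →* kˣ) := Fintype.ofFinite _
  by_contra! h
  have h0 : ∑ l : G →* kˣ, D.weightSum l • v = 0 := Finset.sum_eq_zero fun l _ => h l
  simp only [weightSum_smul] at h0
  rw [Finset.sum_comm] at h0
  simp only [← Finset.sum_smul] at h0
  -- Column orthogonality: only the summand `g = 1` survives.
  rw [Finset.sum_eq_single 1] at h0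
  · rw [gen_grp_one, one_smul] at h0
    exact hv ((smul_eq_zero.mp h0).resolve_left (by simp))
  · intro g _ hg
    obtain ⟨φ, hφ⟩ := CommGroup.exists_apply_ne_one_of_hasEnoughRootsOfUnity G k hg
    let ev : (G →* kˣ) →* k :=
      (Units.coeHom k).comp (MonoidHom.eval g⁻¹)
    have h1 := sum_hom_units_eq_zero ev fun h1 => hφ <| by
      have h2 : (φ g⁻¹ : kˣ) = 1 := Units.ext (DFunLike.congr_fun h1 φ)
      simpa using h2
    have h2 : ∑ l : G →* kˣ, (((l g)⁻¹ : kˣ) : k) = 0 := by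
      rw [← h1]; exact Finset.sum_congr rfl fun l _ => by simp [ev]
    rw [h2, zero_smul]
  · simp

theorem exists_isPrimitive [CharZero k]
    (hroots : ∀ m : ℕ, 0 < m → ∃ ζ : k, IsPrimitiveRoot ζ m) [Nontrivial M] :
    ∃ (l : G →* kˣ) (v : M), v ≠ 0 ∧ D.IsPrimitive l v := by
  obtain ⟨m, hm⟩ := exists_ne (0 : M)
  have hex : ∃ j : ℕ, D.gen Gen.y ^ j • m = 0 := ⟨D.n, by rw [gen_y_pow, zero_smul]⟩
  classical
  obtain ⟨j, hj⟩ : ∃ j, Nat.find hex = j + 1 := Nat.exists_eq_succ_of_ne_zero fun h => hm <| by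
    simpa [h] using Nat.find_spec hex
  have hj0 : D.gen Gen.y ^ j • m ≠ 0 := Nat.find_min hex (by omega)
  have hj1 : D.gen Gen.y • D.gen Gen.y ^ j • m = 0 := by
    rw [← mul_smul, ← pow_succ', ← hj]; exact Nat.find_spec hex
  obtain ⟨l, hl⟩ := exists_weightSum_smul_ne_zero (D := D) hroots hj0
  exact ⟨l, _, hl, isPrimitive_weightSum_smul l hj1⟩

end Fintype

theorem IsPrimitive.map {N : Type*} [AddCommGroup N] [Module D.H N] [Module k N]
    [IsScalarTower k D.H N] {l : G →* kˣ} {v : M} (h : D.IsPrimitive l v) (f : M →ₗ[D.H] N) :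
    D.IsPrimitive l (f v) where
  weight g := by
    rw [← map_smul, h.weight g, ← algebraMap_smul D.H, map_smul, algebraMap_smul]
  y_smul := by rw [← map_smul, h.y_smul, map_zero]

theorem IsPrimitive.Y_smul {l : G →* kˣ} {v : M} (h : D.IsPrimitive l v) (u : D.H)
    (hu : u ∈ D.Y) : u • v = D.weightChar l ⟨u, hu⟩ • v := by
  induction hu using Algebra.adjoin_induction with
  | mem u hu =>
    rcases hu with ⟨g, rfl⟩ | rfl
    · exact (h.weight g).trans (congrArg (· • v) (D.weightChar_grp l g).symm)
    · refine h.y_smul.trans ((zero_smul k v).symm.trans ?_)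
      exact congrArg (· • v) (D.weightChar_y l).symm
  | algebraMap r =>
    rw [algebraMap_smul]
    exact congrArg (· • v) ((D.weightChar l).commutes r).symm
  | add u w hu' hw' hu hw =>
    rw [add_smul, hu, hw, ← add_smul]
    exact congrArg (· • v) (map_add (D.weightChar l) ⟨u, hu'⟩ ⟨w, hw'⟩).symm
  | mul u w hu' hw' hu hw =>
    rw [mul_smul, hw, smul_algebra_smul_comm, hu, smul_smul, mul_comm]
    exact congrArg (· • v) (map_mul (D.weightChar l) ⟨u, hu'⟩ ⟨w, hw'⟩).symm

/-! ### The modules `Z(λ)` -/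

variable (D)

instance (l : G →* kˣ) : Module k (D.Z l) := Module.compHom _ (algebraMap k D.H)

instance (l : G →* kˣ) : IsScalarTower k D.H (D.Z l) where
  smul_assoc c u z := by
    rw [Algebra.smul_def, mul_smul]
    rfl

/-- The relations defining `Z(λ)` as a quotient of `H ⊗ k_λ`. -/
def relZ (l : G →* kˣ) : Submodule D.H (D.H ⊗[k] D.OneDim l) :=
  Submodule.span D.H {t | ∃ (a : D.H) (b : D.Y) (v : D.OneDim l),
    t = (a * (b : D.H)) ⊗ₜ[k] v - a ⊗ₜ[k] (b • v)}

/-- The quotient map `H ⊗ k_λ → Z(λ)`. -/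
def mkZ (l : G →* kˣ) : D.H ⊗[k] D.OneDim l →ₗ[D.H] D.Z l := (D.relZ l).mkQ

theorem mkZ_surjective (l : G →* kˣ) : Function.Surjective (D.mkZ l) :=
  (D.relZ l).mkQ_surjective

theorem mkZ_mul_tmul (l : G →* kˣ) (u : D.H) (b : D.Y) (c : D.OneDim l) :
    D.mkZ l ((u * (b : D.H)) ⊗ₜ c) = D.mkZ l (u ⊗ₜ (b • c)) :=
  (Submodule.Quotient.eq _).mpr (Submodule.subset_span ⟨u, b, c, rfl⟩)

/-- The element `1` of `k_λ`. -/
def oneDimOne (l : G →* kˣ) : D.OneDim l := (1 : k)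

/-- The generator `1 ⊗ 1` of `Z(λ)`. -/
def genZ (l : G →* kˣ) : D.Z l := D.mkZ l (1 ⊗ₜ D.oneDimOne l)

theorem Y_smul_oneDimOne (l : G →* kˣ) (b : D.Y) :
    b • D.oneDimOne l = D.weightChar l b • D.oneDimOne l := rfl

theorem Y_smul_genZ (l : G →* kˣ) (b : D.Y) :
    (b : D.H) • D.genZ l = D.weightChar l b • D.genZ l := by
  rw [← algebraMap_smul D.H, genZ, ← map_smul, ← map_smul, TensorProduct.smul_tmul',
    TensorProduct.smul_tmul', smul_eq_mul, smul_eq_mul, mul_one, mul_one]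
  have h := D.mkZ_mul_tmul l 1 b (D.oneDimOne l)
  rw [one_mul] at h
  rw [h, Y_smul_oneDimOne, ← TensorProduct.smul_tmul, Algebra.algebraMap_eq_smul_one]

theorem isPrimitive_genZ (l : G →* kˣ) : D.IsPrimitive l (D.genZ l) where
  weight g := by
    have h := D.Y_smul_genZ l ⟨D.gen (Gen.grp g), D.grp_mem_Y g⟩
    rwa [weightChar_grp] at h
  y_smul := by
    have h := D.Y_smul_genZ l ⟨D.gen Gen.y, D.y_mem_Y⟩
    rwa [weightChar_y, zero_smul] at h

theorem exists_smul_genZ (l : G →* kˣ) (z : D.Z l) : ∃ u : D.H, z = u • D.genZ l := by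
  obtain ⟨t, rfl⟩ := D.mkZ_surjective l z
  induction t using TensorProduct.induction_on with
  | zero => exact ⟨0, by simp⟩
  | tmul u c =>
    refine ⟨(show k from c) • u, ?_⟩
    rw [genZ, ← map_smul, TensorProduct.smul_tmul', smul_eq_mul, mul_one, TensorProduct.smul_tmul]
    congr 2
    exact (mul_one (show k from c)).symm
  | add s t hs ht =>
    obtain ⟨a, ha⟩ := hs
    obtain ⟨b, hb⟩ := ht
    exact ⟨a + b, by rw [map_add, ha, hb, add_smul]⟩

variable {D}

/-- The universal property of `Z(λ)`: a primitive vector of weight `λ` is the image of the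
generator. -/
theorem IsPrimitive.exists_hom {l : G →* kˣ} {v : M} (h : D.IsPrimitive l v) :
    ∃ f : D.Z l →ₗ[D.H] M, f (D.genZ l) = v := by
  let e : D.OneDim l →ₗ[k] M := LinearMap.toSpanSingleton k M v
  have he : ∀ (b : D.Y) (c : D.OneDim l), e (b • c) = (b : D.H) • e c := by
    intro b c
    have h1 : e (b • c) = (D.weightChar l b * (show k from c)) • v := rfl
    have h2 : e c = (show k from c) • v := rfl
    rw [h1, h2, smul_algebra_smul_comm, h.Y_smul b b.2, smul_smul, mul_comm]
  let F : D.H ⊗[k] D.OneDim l →ₗ[D.H] M :=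
    TensorProduct.AlgebraTensorModule.lift (LinearMap.toSpanSingleton D.H _ e)
  have hF : ∀ (u : D.H) (c : D.OneDim l), F (u ⊗ₜ c) = u • e c := fun u c => rfl
  have hker : D.relZ l ≤ LinearMap.ker F := by
    refine Submodule.span_le.mpr ?_
    rintro _ ⟨u, b, c, rfl⟩
    rw [SetLike.mem_coe, LinearMap.mem_ker, map_sub, hF, hF, he, mul_smul, sub_self]
  refine ⟨(D.relZ l).liftQ F hker, ?_⟩
  have h1 : (D.relZ l).liftQ F hker (D.genZ l) = F (1 ⊗ₜ D.oneDimOne l) :=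
    Submodule.liftQ_apply _ _ _
  refine h1.trans ((hF _ _).trans ?_)
  rw [one_smul]
  exact one_smul k v

variable (D)

theorem genZ_ne_zero (l : G →* kˣ) : D.genZ l ≠ 0 := by
  let : Module D.H (Fin D.n → k) := Module.compHom _ (D.rep l).toRingHom
  have hs : ∀ (u : D.H) (f : Fin D.n → k), u • f = D.rep l u f := fun _ _ => rfl
  have : IsScalarTower k D.H (Fin D.n → k) :=
    ⟨fun c u f => by rw [hs, hs, map_smul, LinearMap.smul_apply]⟩
  have hv : D.IsPrimitive l D.v0 :=
    ⟨fun g => by rw [hs, rep_grp_v0], by rw [hs, rep_y_v0, zero_smul]⟩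
  obtain ⟨f, hf⟩ := hv.exists_hom
  intro h0
  rw [h0, map_zero] at hf
  have h1 := congrFun hf ⟨0, D.n_pos⟩
  simp [v0] at h1

theorem eq_top_of_genZ_mem {l : G →* kˣ} {N : Submodule D.H (D.Z l)} (h : D.genZ l ∈ N) :
    N = ⊤ := by
  refine eq_top_iff.mpr fun z _ => ?_
  obtain ⟨u, rfl⟩ := D.exists_smul_genZ l z
  exact N.smul_mem u h

theorem weightSum_smul_eq_zero_of_mem [Fintype G] {l : G →* kˣ} {N : Submodule D.H (D.Z l)}
    (hN : N ≠ ⊤) {z : D.Z l} (hz : z ∈ N) : D.weightSum l • z = 0 := by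
  obtain ⟨u, rfl⟩ := D.exists_smul_genZ l z
  obtain ⟨c, hc⟩ := (D.isPrimitive_genZ l).weightSum_smul_mem u
  by_contra h0
  have hc0 : c ≠ 0 := by rintro rfl; rw [zero_smul] at hc; exact h0 hc
  refine hN (D.eq_top_of_genZ_mem ?_)
  have h1 : algebraMap k D.H c⁻¹ • D.weightSum l • u • D.genZ l ∈ N :=
    N.smul_mem _ (N.smul_mem _ hz)
  rwa [hc, algebraMap_smul, smul_smul, inv_mul_cancel₀ hc0, one_smul] at h1

theorem R_ne_top [CharZero k] [Finite G] (l : G →* kˣ) : D.R l ≠ ⊤ := by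
  have := Fintype.ofFinite G
  intro h
  have hz : ∀ z ∈ D.R l, D.weightSum l • z = 0 := by
    intro z hz
    rw [R, sSup_eq_iSup'] at hz
    induction hz using Submodule.iSup_induction' with
    | mem N z hz => exact D.weightSum_smul_eq_zero_of_mem N.2 hz
    | zero => simp
    | add z w _ _ hz hw => rw [smul_add, hz, hw, add_zero]
  have h1 := hz (D.genZ l) (h ▸ Submodule.mem_top)
  rw [(D.isPrimitive_genZ l).weight.weightSum_smul] at h1
  exact (smul_eq_zero.mp h1).elim (Nat.cast_ne_zero.mpr Fintype.card_ne_zero) (D.genZ_ne_zero l)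

theorem isSimpleModule_quotient_iff [CharZero k] [Finite G] (l : G →* kˣ)
    (N : Submodule D.H (D.Z l)) : IsSimpleModule D.H (D.Z l ⧸ N) ↔ N = D.R l := by
  have hle : ∀ N : Submodule D.H (D.Z l), N ≠ ⊤ → N ≤ D.R l := fun N hN => le_sSup hN
  rw [isSimpleModule_iff_isCoatom]
  constructor
  · intro h
    by_contra hne
    exact D.R_ne_top l (h.2 _ (lt_of_le_of_ne (hle N h.1) hne))
  · rintro rfl
    refine ⟨D.R_ne_top l, fun N hN => ?_⟩
    by_contra h
    exact hN.not_ge (hle N h)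

/-! ### The simple modules -/

theorem exists_equiv_L [CharZero k] [Finite G]
    (hroots : ∀ m : ℕ, 0 < m → ∃ ζ : k, IsPrimitiveRoot ζ m)
    (M : Type*) [AddCommGroup M] [Module D.H M] [IsSimpleModule D.H M] :
    ∃ l : G →* kˣ, Nonempty (M ≃ₗ[D.H] D.L l) := by
  have := Fintype.ofFinite G
  let : Module k M := Module.compHom M (algebraMap k D.H)
  have : IsScalarTower k D.H M := ⟨fun c u z => by rw [Algebra.smul_def, mul_smul]; rfl⟩
  have := IsSimpleModule.nontrivial D.H M
  obtain ⟨l, v, hv0, hv⟩ := exists_isPrimitive (D := D) (M := M) hroots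
  obtain ⟨f, hf⟩ := hv.exists_hom
  have hsurj : Function.Surjective f :=
    LinearMap.surjective_of_ne_zero fun h => hv0 <| by rw [← hf, h, LinearMap.zero_apply]
  have e := f.quotKerEquivOfSurjective hsurj
  have hker := (D.isSimpleModule_quotient_iff l (LinearMap.ker f)).mp (IsSimpleModule.congr e)
  exact ⟨l, ⟨e.symm.trans (Submodule.quotEquivOfEq _ _ hker)⟩⟩

theorem eq_of_L_equiv [CharZero k] [Finite G] {l m : G →* kˣ} (e : D.L l ≃ₗ[D.H] D.L m) :
    l = m := by
  have := Fintype.ofFinite G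
  by_contra hlm
  let (l : G →* kˣ) : Module k (D.L l) := Module.compHom _ (algebraMap k D.H)
  have (l : G →* kˣ) : IsScalarTower k D.H (D.L l) :=
    ⟨fun c u z => by rw [Algebra.smul_def, mul_smul]; rfl⟩
  have hprim (l : G →* kˣ) : D.IsPrimitive l ((D.R l).mkQ (D.genZ l)) :=
    (D.isPrimitive_genZ l).map _
  have hgen (l : G →* kˣ) (z : D.L l) : ∃ u : D.H, z = u • (D.R l).mkQ (D.genZ l) := by
    obtain ⟨z, rfl⟩ := (D.R l).mkQ_surjective z
    obtain ⟨u, rfl⟩ := D.exists_smul_genZ l z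
    exact ⟨u, map_smul _ _ _⟩
  have hx (z : D.L m) : D.weightSum l • D.gen Gen.x • z = 0 := by
    obtain ⟨u, hu⟩ := hgen l (e.symm z)
    rw [← e.symm.map_eq_zero_iff, map_smul, map_smul, hu]
    exact (hprim l).weightSum_x_smul u
  have hzero : D.weightSum l • (D.R l).mkQ (D.genZ l) = 0 := by
    obtain ⟨u, hu⟩ := hgen m (e ((D.R l).mkQ (D.genZ l)))
    rw [← e.map_eq_zero_iff, map_smul, hu]
    exact (hprim m).weightSum_smul_eq_zero hlm hx u
  rw [(hprim l).weight.weightSum_smul, smul_eq_zero, Submodule.mkQ_apply,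
    Submodule.Quotient.mk_eq_zero] at hzero
  exact hzero.elim (Nat.cast_ne_zero.mpr Fintype.card_ne_zero)
    fun h => D.R_ne_top l (D.eq_top_of_genZ_mem h)

end Datum

end QuantumPlane

end

theorem theorem1p1 {k : Type u} {G : Type v} [Field k] [CharZero k] [CommGroup G] [Finite G]
    (hroots : ∀ m : ℕ, 0 < m → ∃ ζ : k, IsPrimitiveRoot ζ m)
    (D : QuantumPlane.Datum k G) :
    -- `Z(λ)` has exactly one maximal submodule `R(λ)`, i.e. exactly one simple quotient `L(λ)`
    (∀ (l : G →* kˣ) (N : Submodule D.H (D.Z l)),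
      IsSimpleModule D.H (D.Z l ⧸ N) ↔ N = D.R l) ∧
    -- every `L(λ)` is a simple module
    (∀ l : G →* kˣ, IsSimpleModule D.H (D.L l)) ∧
    -- every simple module is isomorphic to some `L(λ)`
    (∀ (M : Type w) [AddCommGroup M] [Module D.H M], IsSimpleModule D.H M →
      ∃ l : G →* kˣ, Nonempty (M ≃ₗ[D.H] D.L l)) ∧
    -- `L(λ)` and `L(μ)` are isomorphic only if `λ = μ`
    (∀ l m : G →* kˣ, Nonempty (D.L l ≃ₗ[D.H] D.L m) → l = m) := by
  refine ⟨fun l N => D.isSimpleModule_quotient_iff l N,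
    fun l => (D.isSimpleModule_quotient_iff l _).mpr rfl, ?_, ?_⟩
  · intro M _ _ _
    exact D.exists_equiv_L hroots M
  · rintro l m ⟨e⟩
    exact D.eq_of_L_equiv e
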